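/- Let $d\ge 1$, let $\Sigma:=\{x\in\mathbb{R}^d: 0\le x_i\le 1,\ \sum_{j=1}^d x_j\le 1\}$, and let $C\subset\mathbb{R}^d$ be a convex body (a nonempty compact convex set) with $\epsilon\Sigma\subset C\subset\delta\Sigma$ for some $\delta>\epsilon>0$. For $n\in\mathbb{N}$ let $\alpha(1),\dots,\alpha(d_n)$ be an enumeration of the finite set $nC\cap\mathbb{N}^d$ (where $0\in\mathbb{N}$), let $e_j(z):=z^{\alpha(j)}=z_1^{\alpha_1(j)}\cdots z_d^{\alpha_d(j)}$ be the corresponding monomials on $\mathbb{C}^d$, and let $l_n:=\sum_{j=1}^{d_n}\deg(e_j)=\sum_{j=1}^{d_n}(\alpha_1(j)+\dots+\alpha_d(j))$. For a compact set $K\subset\mathbb{C}^d$ let $$V_n(K):=\sup_{\zeta_1,\dots,\zeta_{d_n}\in K}\bigl|\det[e_i(\zeta_j)]_{i,j=1,\dots,d_n}\bigr|$$ (a maximum if $K\neq\emptyset$, and $0$ if $K=\emptyset$), and define the $C$-transfinite diameter of $K$ by $$\delta_C(K):=\limsup_{n\to\infty}V_n(K)^{1/l_n}.$$ Then for every real $t>0$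 and every compact $K\subset\mathbb{C}^d$, $$\delta_{tC}(K)=\delta_C(K),$$ where $tC=\{tx: x\in C\}$. -/

import Mathlib

open scoped Pointwise ENNReal

noncomputable section

/-- The unit simplex `Σ ⊆ ℝ^d` with vertices the origin and the standard unit vectors. -/
def unitSimplex (d : ℕ) : Set (Fin d → ℝ) :=
  {x | (∀ i, 0 ≤ x i ∧ x i ≤ 1) ∧ ∑ i, x i ≤ 1}

/-- The standing assumption on a convex body `C`: `ε Σ ⊆ C ⊆ δ Σ` for some `δ > ε > 0`. In
particular `C` lies in the nonnegative orthant and has nonempty interior. -/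
def SimplexComparable {d : ℕ} (C : ConvexBody (Fin d → ℝ)) : Prop :=
  ∃ ε δ : ℝ, 0 < ε ∧ ε < δ ∧ ε • unitSimplex d ⊆ C ∧ (C : Set (Fin d → ℝ)) ⊆ δ • unitSimplex d

/-- The set `nC ∩ ℕ^d` of exponents of the monomials spanning `Poly(nC)`. -/
def exponentSet {d : ℕ} (C : ConvexBody (Fin d → ℝ)) (n : ℕ) : Set (Fin d → ℕ) :=
  {α | (fun i => (α i : ℝ)) ∈ (n : ℝ) • (C : Set (Fin d → ℝ))}

theorem exponentSet_finite {d : ℕ} (C : ConvexBody (Fin d → ℝ)) (n : ℕ) :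
    (exponentSet C n).Finite := by
  obtain ⟨R, hR⟩ := (C.isBounded.smul₀ (n : ℝ)).subset_closedBall 0
  refine (Set.finite_Iic (fun _ : Fin d => ⌈R⌉₊)).subset fun α hα i => ?_
  have h1 : ‖fun i => (α i : ℝ)‖ ≤ R := by simpa using hR hα
  have h2 := (norm_le_pi_norm (fun i => (α i : ℝ)) i).trans h1
  have h3 : (α i : ℝ) ≤ ⌈R⌉₊ := by
    simpa using h2.trans (Nat.le_ceil R)
  exact_mod_cast h3

/-- `nC ∩ ℕ^d` as a finite set; its cardinality is `d_n = dim Poly(nC)`. -/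
def exponents {d : ℕ} (C : ConvexBody (Fin d → ℝ)) (n : ℕ) : Finset (Fin d → ℕ) :=
  (exponentSet_finite C n).toFinset

/-- The monomial `z^α = z_1^{α_1} ⋯ z_d^{α_d}`. -/
def monomialFun {d : ℕ} (α : Fin d → ℕ) (z : Fin d → ℂ) : ℂ :=
  ∏ i, z i ^ α i

/-- The generalized Vandermonde determinant of `d_n` points of `ℂ^d`. Points and monomials are both
indexed by `nC ∩ ℕ^d`; enumerating either in another way changes the determinant at most by a
sign. -/
def vandermondeDet {d : ℕ} (C : ConvexBody (Fin d → ℝ)) (n : ℕ)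
    (ζ : exponents C n → (Fin d → ℂ)) : ℂ :=
  (Matrix.of fun α β : exponents C n => monomialFun α.1 (ζ β)).det

/-- `V_n(K)`, the largest modulus of a Vandermonde determinant of points of `K`. It is taken in
`[0, ∞]`, so that no boundedness has to be known; for compact `K` it is finite. -/
def maxVandermonde {d : ℕ} (C : ConvexBody (Fin d → ℝ)) (K : Set (Fin d → ℂ)) (n : ℕ) : ℝ≥0∞ :=
  ⨆ (ζ : exponents C n → (Fin d → ℂ)) (_ : ∀ β, ζ β ∈ K), ‖vandermondeDet C n ζ‖ₑ

/-- `l_n`, the sum of the (total) degrees of the monomials spanning `Poly(nC)`. -/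
def degreeSum {d : ℕ} (C : ConvexBody (Fin d → ℝ)) (n : ℕ) : ℕ :=
  ∑ α ∈ exponents C n, ∑ i, α i

/-- The `C`-transfinite diameter `δ_C(K) = limsup V_n(K)^{1 / l_n}`. -/
def transfiniteDiameter {d : ℕ} (C : ConvexBody (Fin d → ℝ)) (K : Set (Fin d → ℂ)) : ℝ≥0∞ :=
  Filter.limsup (fun n : ℕ => maxVandermonde C K n ^ (1 / (degreeSum C n : ℝ))) Filter.atTop

end

/-!
The proof compares Vandermonde determinants for nested sets of exponents. If `A ⊆ B` are finite
sets of exponents, repeated Laplace expansion of a determinant for `B` along the rows belonging to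
`B \ A` bounds its modulus by the maximal determinant for `A`, times a factor at most `#B · M ^ deg α`
for each `α ∈ B \ A`, where `M ≥ 1` bounds the coordinates of the points of `K`
(`maxDet_le_of_subset`).

Take `A = ⌊t n⌋ C ∩ ℕ^d` and `B = t n C ∩ ℕ^d`; then `A ⊆ B` because `C` is convex and contains `0`.
Each factor is at most `R ^ n` for a constant `R` (`exists_maxVandermonde_le`). The number of
lattice points in `s C` is asymptotic to `s ^ d vol C`, so there are only `o(n ^ d)` factors
(`tendsto_card_sdiff_div_pow`), whereas the degree sum for `B` has order at least `n ^ (d + 1)`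
(`SimplexComparable.exists_le_degreeSum`). Hence the `l`-th root of the product of the factors tends
to `1`, as does the ratio of the two degree sums, and
`δ_{tC}(K) ≤ limsup_n V_{⌊t n⌋}(K) ^ (1 / l_{⌊t n⌋}) ≤ δ_C(K)`
(`transfiniteDiameter_smul_le`). Only an upper bound is needed: the reverse inequality is the same
statement for the body `t C` and the factor `t⁻¹`, so it is not necessary to know that the limsup
is a limit.
-/

open Filter Topology MeasureTheory

/-! ### Determinants of nested families of exponents -/

/-- The largest modulus of a generalized Vandermonde determinant with points in `K`, for an
arbitrary finite family `f` of exponents. -/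
noncomputable def maxDet {d : ℕ} {ι : Type*} [Fintype ι] [DecidableEq ι] (f : ι → Fin d → ℕ)
    (K : Set (Fin d → ℂ)) : ℝ≥0∞ :=
  ⨆ (ζ : ι → Fin d → ℂ) (_ : ∀ i, ζ i ∈ K),
    ‖(Matrix.of fun i j => monomialFun (f i) (ζ j)).det‖ₑ

theorem maxVandermonde_eq_maxDet {d : ℕ} (C : ConvexBody (Fin d → ℝ)) (K : Set (Fin d → ℂ))
    (n : ℕ) :
    maxVandermonde C K n = maxDet (Subtype.val : exponents C n → Fin d → ℕ) K :=
  rfl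

theorem maxDet_comp_equiv_le {d : ℕ} {ι κ : Type*} [Fintype ι] [DecidableEq ι] [Fintype κ]
    [DecidableEq κ] (e : κ ≃ ι) (f : ι → Fin d → ℕ) (K : Set (Fin d → ℂ)) :
    maxDet (f ∘ e) K ≤ maxDet f K := by
  refine iSup₂_le fun ζ hζ => ?_
  refine le_iSup₂_of_le (ζ ∘ e.symm) (fun i => hζ _) (le_of_eq ?_)
  rw [← Matrix.det_submatrix_equiv_self e]
  congr 2
  ext i j
  simp

theorem maxDet_comp_equiv {d : ℕ} {ι κ : Type*} [Fintype ι] [DecidableEq ι] [Fintype κ]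
    [DecidableEq κ] (e : κ ≃ ι) (f : ι → Fin d → ℕ) (K : Set (Fin d → ℂ)) :
    maxDet (f ∘ e) K = maxDet f K := by
  refine (maxDet_comp_equiv_le e f K).antisymm ?_
  simpa [Function.comp_assoc] using maxDet_comp_equiv_le e.symm (f ∘ e) K

theorem enorm_monomialFun_le {d : ℕ} {M : ℝ≥0∞} (α : Fin d → ℕ) {z : Fin d → ℂ}
    (hz : ∀ i, ‖z i‖ₑ ≤ M) : ‖monomialFun α z‖ₑ ≤ M ^ ∑ i, α i := by
  have h : ‖monomialFun α z‖ₑ = ∏ i, ‖z i‖ₑ ^ α i := by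
    simp only [monomialFun, enorm_eq_nnnorm, nnnorm_prod, nnnorm_pow]
    push_cast
    rfl
  rw [h, ← Finset.prod_pow_eq_pow_sum]
  exact Finset.prod_le_prod' fun i _ => pow_le_pow_left' (hz i) _

/-- Laplace expansion along the row of the additional exponent. -/
theorem maxDet_cons_le {d n : ℕ} {M : ℝ≥0∞} {K : Set (Fin d → ℂ)}
    (hM : ∀ z ∈ K, ∀ i, ‖z i‖ₑ ≤ M) (α : Fin d → ℕ) (f : Fin n → Fin d → ℕ) :
    maxDet (Fin.cons α f : Fin (n + 1) → Fin d → ℕ) K ≤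
      (n + 1 : ℕ) * M ^ (∑ i, α i) * maxDet f K := by
  refine iSup₂_le fun ζ hζ => ?_
  rw [Matrix.det_succ_row_zero]
  refine (enorm_sum_le _ _).trans ?_
  have h : ∀ j ∈ (Finset.univ : Finset (Fin (n + 1))), ‖(-1 : ℂ) ^ (j : ℕ) *
      (Matrix.of fun i j => monomialFun ((Fin.cons α f : Fin (n + 1) → Fin d → ℕ) i) (ζ j)) 0 j *
      ((Matrix.of fun i j => monomialFun ((Fin.cons α f : Fin (n + 1) → Fin d → ℕ) i)
        (ζ j)).submatrix Fin.succ j.succAbove).det‖ₑ ≤ M ^ (∑ i, α i) * maxDet f K := by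
    intro j _
    rw [enorm_mul, enorm_mul]
    have h1 : ‖(-1 : ℂ) ^ (j : ℕ)‖ₑ = 1 := by simp [enorm_eq_nnnorm]
    rw [h1, one_mul]
    gcongr
    · exact enorm_monomialFun_le α (hM _ (hζ j))
    · exact le_iSup₂_of_le (fun k => ζ (j.succAbove k)) (fun k => hζ _) le_rfl
  refine (Finset.sum_le_sum h).trans ?_
  simp [mul_assoc]

theorem maxDet_insert_le {d : ℕ} {M : ℝ≥0∞} {K : Set (Fin d → ℂ)}
    (hM : ∀ z ∈ K, ∀ i, ‖z i‖ₑ ≤ M) {α : Fin d → ℕ} {A : Finset (Fin d → ℕ)} (hα : α ∉ A) :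
    maxDet (Subtype.val : ↥(insert α A) → Fin d → ℕ) K ≤
      (insert α A).card * M ^ (∑ i, α i) * maxDet (Subtype.val : A → Fin d → ℕ) K := by
  let e : Fin (A.card + 1) ≃ ↥(insert α A) :=
    (finSuccEquiv A.card).trans
      ((Equiv.optionCongr A.equivFin.symm).trans (Finset.subtypeInsertEquivOption hα).symm)
  have he : (Subtype.val : ↥(insert α A) → Fin d → ℕ) ∘ e =
      Fin.cons α ((Subtype.val : A → Fin d → ℕ) ∘ A.equivFin.symm) := by
    funext i
    refine Fin.cases ?_ (fun j => ?_) i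
    · simp [e, Finset.subtypeInsertEquivOption, -Equiv.optionCongr_symm]
    · simp [e, Finset.subtypeInsertEquivOption, -Equiv.optionCongr_symm]
  rw [← maxDet_comp_equiv e, he, ← maxDet_comp_equiv A.equivFin.symm,
    Finset.card_insert_of_notMem hα]
  exact maxDet_cons_le hM α _

/-- Enlarging the set of exponents by `D` costs at most one factor per point of `D`. -/
theorem maxDet_union_le {d : ℕ} {M : ℝ≥0∞} {K : Set (Fin d → ℂ)}
    (hM : ∀ z ∈ K, ∀ i, ‖z i‖ₑ ≤ M) (A D : Finset (Fin d → ℕ)) (hAD : Disjoint A D) :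
    maxDet (Subtype.val : ↥(D ∪ A) → Fin d → ℕ) K ≤
      (D ∪ A).card ^ D.card * M ^ (∑ α ∈ D, ∑ i, α i) *
        maxDet (Subtype.val : A → Fin d → ℕ) K := by
  induction D using Finset.induction_on with
  | empty =>
    rw [Finset.empty_union]
    simp
  | insert α D hα ih =>
    rw [Finset.disjoint_insert_right] at hAD
    have hα' : α ∉ D ∪ A := by simp [hα, hAD.1]
    rw [Finset.insert_union, Finset.card_insert_of_notMem hα, Finset.sum_insert hα, pow_succ',
      pow_add]
    calc _ ≤ _ := maxDet_insert_le hM hα'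
      _ ≤ (insert α (D ∪ A)).card * M ^ (∑ i, α i) * ((insert α (D ∪ A)).card ^ D.card *
          M ^ (∑ α ∈ D, ∑ i, α i) * maxDet (Subtype.val : A → Fin d → ℕ) K) := by
        gcongr
        refine (ih hAD.2).trans ?_
        gcongr
        exact Finset.subset_insert _ _
      _ = _ := by ring

theorem maxDet_le_of_subset {d : ℕ} {M : ℝ≥0∞} {K : Set (Fin d → ℂ)}
    (hM : ∀ z ∈ K, ∀ i, ‖z i‖ₑ ≤ M) {A B : Finset (Fin d → ℕ)} (hAB : A ⊆ B) :
    maxDet (Subtype.val : B → Fin d → ℕ) K ≤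
      B.card ^ (B \ A).card * M ^ (∑ α ∈ B \ A, ∑ i, α i) *
        maxDet (Subtype.val : A → Fin d → ℕ) K := by
  have h := maxDet_union_le hM A (B \ A) Finset.disjoint_sdiff
  rwa [Finset.sdiff_union_of_subset hAB] at h

/-! ### Lattice points and degree sums of dilates -/

theorem mem_exponents {d : ℕ} {C : ConvexBody (Fin d → ℝ)} {n : ℕ} {α : Fin d → ℕ} :
    α ∈ exponents C n ↔ (fun i => (α i : ℝ)) ∈ (n : ℝ) • (C : Set (Fin d → ℝ)) := by
  simp [exponents, exponentSet]

theorem SimplexComparable.nonneg {d : ℕ} {C : ConvexBody (Fin d → ℝ)} (hC : SimplexComparable C)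
    {x : Fin d → ℝ} (hx : x ∈ C) (i : Fin d) : 0 ≤ x i := by
  obtain ⟨ε, δ, hε, hδ, -, h⟩ := hC
  obtain ⟨y, hy, rfl⟩ := h hx
  exact mul_nonneg (hε.trans hδ).le (hy.1 i).1

theorem SimplexComparable.zero_mem {d : ℕ} {C : ConvexBody (Fin d → ℝ)}
    (hC : SimplexComparable C) : 0 ∈ C := by
  obtain ⟨ε, δ, hε, hδ, h, -⟩ := hC
  exact h ⟨0, by simp [unitSimplex], by simp⟩

theorem SimplexComparable.smul {d : ℕ} {C : ConvexBody (Fin d → ℝ)} (hC : SimplexComparable C)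
    {t : ℝ} (ht : 0 < t) : SimplexComparable (t • C) := by
  obtain ⟨ε, δ, hε, hδ, h1, h2⟩ := hC
  refine ⟨t * ε, t * δ, by positivity, by gcongr, ?_, ?_⟩
  · rw [ConvexBody.coe_smul, mul_smul]
    exact Set.smul_set_mono h1
  · rw [ConvexBody.coe_smul, mul_smul]
    exact Set.smul_set_mono h2

theorem card_exponents_eq_card_lattice {d : ℕ} {C : ConvexBody (Fin d → ℝ)}
    (hC : SimplexComparable C) {n : ℕ} (hn : n ≠ 0) :
    (exponents C n).card = Nat.card ↑((C : Set (Fin d → ℝ)) ∩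
      ((n : ℝ)⁻¹ • Submodule.span ℤ (Set.range (Pi.basisFun ℝ (Fin d))) :
        Submodule ℤ (Fin d → ℝ))) := by
  have hn' : (n : ℝ) ≠ 0 := by exact_mod_cast hn
  have : NeZero n := ⟨hn⟩
  rw [← Nat.card_eq_finsetCard]
  refine Nat.card_congr (Equiv.ofBijective
    (fun α => ⟨fun i => (n : ℝ)⁻¹ * (α.1 i : ℝ), ?_, ?_⟩) ⟨?_, ?_⟩)
  · have := mem_exponents.1 α.2
    rwa [Set.mem_smul_set_iff_inv_smul_mem₀ hn'] at this
  · rw [SetLike.mem_coe, BoxIntegral.unitPartition.mem_smul_span_iff]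
    exact fun i => ⟨α.1 i, by simp [hn']⟩
  · intro α β h
    ext i
    have := congrFun (congrArg Subtype.val h) i
    simpa [hn'] using this
  · rintro ⟨x, hx, hx'⟩
    rw [SetLike.mem_coe, BoxIntegral.unitPartition.mem_smul_span_iff] at hx'
    choose k hk using hx'
    have hk0 : ∀ i, 0 ≤ k i := fun i => by
      have h1 : (0 : ℝ) ≤ algebraMap ℤ ℝ (k i) := by
        rw [hk i]
        exact mul_nonneg (Nat.cast_nonneg n) (hC.nonneg hx i)
      simpa using h1
    have hkx : ∀ i, (((k i).toNat : ℕ) : ℝ) = n * x i := fun i => by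
      rw [← hk i]
      have : (((k i).toNat : ℤ) : ℝ) = ((k i : ℤ) : ℝ) := by rw [Int.toNat_of_nonneg (hk0 i)]
      rwa [Int.cast_natCast] at this
    refine ⟨⟨fun i => (k i).toNat, mem_exponents.2 ⟨x, hx, ?_⟩⟩, ?_⟩
    · ext i
      simp [hkx]
    · ext i
      simp [hkx, hn']

theorem tendsto_card_exponents_div_pow {d : ℕ} {C : ConvexBody (Fin d → ℝ)}
    (hC : SimplexComparable C) :
    Tendsto (fun n : ℕ => ((exponents C n).card : ℝ) / (n : ℝ) ^ d) atTop
      (𝓝 (volume.real (C : Set (Fin d → ℝ)))) := by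
  have h := tendsto_card_div_pow_atTop_volume (C : Set (Fin d → ℝ)) C.isBounded
    C.isCompact.measurableSet (C.convex.addHaar_frontier volume)
  refine h.congr' ?_
  filter_upwards [eventually_ne_atTop 0] with n hn
  rw [card_exponents_eq_card_lattice hC hn, Fintype.card_fin]
  rfl

theorem SimplexComparable.exists_degree_le {d : ℕ} {C : ConvexBody (Fin d → ℝ)}
    (hC : SimplexComparable C) :
    ∃ D : ℕ, ∀ n, ∀ α ∈ exponents C n, ∑ i, α i ≤ D * n := by
  obtain ⟨ε, δ, hε, hδ, -, h⟩ := hC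
  refine ⟨⌈δ⌉₊, fun n α hα => ?_⟩
  obtain ⟨x, hx, hxα⟩ := mem_exponents.1 hα
  obtain ⟨y, hy, rfl⟩ := h hx
  have h1 : ∑ i, (α i : ℝ) = n * (δ * ∑ i, y i) := by
    simp_rw [Finset.mul_sum]
    exact Finset.sum_congr rfl fun i _ => (congrFun hxα i).symm
  have h2 : ∑ i, (α i : ℝ) ≤ ⌈δ⌉₊ * n := by
    rw [h1, mul_comm]
    gcongr
    have h3 := mul_le_mul_of_nonneg_left hy.2 (hε.trans hδ).le
    exact (h3.trans_eq (mul_one δ)).trans (Nat.le_ceil δ)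
  exact_mod_cast h2

/-- Crude: `#(nC ∩ ℕ^d) ≤ (D n + 1) ^ d`, weakened to a bound exponential in `n`, which is the form
in which it is used. -/
theorem card_exponents_le {d : ℕ} {C : ConvexBody (Fin d → ℝ)} {D n : ℕ}
    (hD : ∀ α ∈ exponents C n, ∑ i, α i ≤ D * n) :
    (exponents C n).card ≤ (2 ^ (D * d)) ^ n := by
  have hsub : exponents C n ⊆ Fintype.piFinset fun _ : Fin d => Finset.range (D * n + 1) := by
    intro α hα
    rw [Fintype.mem_piFinset]
    intro i
    rw [Finset.mem_range, Nat.lt_succ_iff]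
    exact (Finset.single_le_sum (fun _ _ => Nat.zero_le _) (Finset.mem_univ i)).trans (hD α hα)
  calc (exponents C n).card ≤ _ := Finset.card_le_card hsub
    _ = (D * n + 1) ^ d := by simp
    _ ≤ (2 ^ (D * n)) ^ d := by
      gcongr
      exact Nat.lt_two_pow_self
    _ = (2 ^ (D * d)) ^ n := by ring

/-- The exponents with all entries in `[N, 2N]`, `N = ⌊ε n / (2 d)⌋`, lie in `n C` and have degree
at least `d N`. -/
theorem SimplexComparable.exists_le_degreeSum {d : ℕ} (hd : 1 ≤ d) {C : ConvexBody (Fin d → ℝ)}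
    (hC : SimplexComparable C) :
    ∃ c : ℝ, 0 < c ∧ ∀ᶠ n : ℕ in atTop, c * (n : ℝ) ^ (d + 1) ≤ degreeSum C n := by
  obtain ⟨ε, δ, hε, hδ, h, -⟩ := hC
  have hd0 : (0 : ℝ) < d := by exact_mod_cast hd
  set κ : ℝ := ε / (2 * d) with hκ
  have hκ0 : 0 < κ := by positivity
  refine ⟨(κ / 2) ^ (d + 1), by positivity, ?_⟩
  filter_upwards [eventually_ge_atTop ⌈2 / κ⌉₊, eventually_ge_atTop 1] with n hn hn1
  have hn0 : (0 : ℝ) < n := by exact_mod_cast hn1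
  have hn2 : 2 ≤ κ * n := by
    have := (Nat.le_ceil (2 / κ)).trans (Nat.cast_le.2 hn)
    rwa [div_le_iff₀' hκ0] at this
  set N : ℕ := ⌊κ * n⌋₊ with hN
  have hN1 : (N : ℝ) ≤ κ * n := Nat.floor_le (by positivity)
  have hN2 : κ / 2 * n ≤ N := by
    have := Nat.lt_floor_add_one (κ * n)
    rw [← hN] at this
    linarith
  have hsub : (Fintype.piFinset fun _ : Fin d => Finset.Icc N (2 * N)) ⊆ exponents C n := by
    intro α hα
    rw [Fintype.mem_piFinset] at hα
    have hα' : ∀ i, (α i : ℝ) ≤ 2 * N := fun i => by exact_mod_cast (Finset.mem_Icc.1 (hα i)).2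
    have hsum : ∑ i, (α i : ℝ) ≤ ε * n := by
      calc ∑ i, (α i : ℝ) ≤ ∑ _i : Fin d, 2 * (κ * n) :=
            Finset.sum_le_sum fun i _ => (hα' i).trans (by linarith)
        _ = ε * n := by
          simp only [Finset.sum_const, Finset.card_univ, Fintype.card_fin, nsmul_eq_mul, hκ]
          field_simp
    have hsum' : ∑ i, (ε * n)⁻¹ * (α i : ℝ) ≤ 1 := by
      rw [← Finset.mul_sum, inv_mul_le_iff₀ (by positivity)]
      simpa using hsum
    refine mem_exponents.2 ⟨ε • fun i => (ε * n)⁻¹ * (α i : ℝ), h ⟨_, ⟨fun i => ?_, hsum'⟩, rfl⟩, ?_⟩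
    · exact ⟨by positivity, (Finset.single_le_sum (f := fun i => (ε * n)⁻¹ * (α i : ℝ))
        (fun j _ => by positivity) (Finset.mem_univ i)).trans hsum'⟩
    · ext i
      simp only [Pi.smul_apply, smul_eq_mul]
      field_simp
  have hnat : (N + 1) ^ d * N ≤ degreeSum C n := by
    calc (N + 1) ^ d * N
        ≤ (Fintype.piFinset fun _ : Fin d => Finset.Icc N (2 * N)).card * N := by
          rw [Fintype.card_piFinset]
          simp only [Nat.card_Icc, Finset.prod_const, Finset.card_univ, Fintype.card_fin]
          gcongr
          omega
      _ ≤ ∑ α ∈ Fintype.piFinset fun _ : Fin d => Finset.Icc N (2 * N), ∑ i, α i := by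
          rw [← smul_eq_mul]
          refine Finset.card_nsmul_le_sum _ _ _ fun α hα => ?_
          rw [Fintype.mem_piFinset] at hα
          exact (Finset.mem_Icc.1 (hα ⟨0, hd⟩)).1.trans
            (Finset.single_le_sum (fun _ _ => Nat.zero_le _) (Finset.mem_univ _))
      _ ≤ _ := Finset.sum_le_sum_of_subset hsub
  calc (κ / 2) ^ (d + 1) * (n : ℝ) ^ (d + 1) = (κ / 2 * n) ^ d * (κ / 2 * n) := by ring
    _ ≤ (N + 1 : ℝ) ^ d * N := by
      gcongr
      linarith
    _ ≤ degreeSum C n := by exact_mod_cast hnat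

theorem exponents_subset_exponents_smul {d : ℕ} {C : ConvexBody (Fin d → ℝ)}
    (hC : SimplexComparable C) {t : ℝ} {m n : ℕ} (hmn : (m : ℝ) ≤ t * n) :
    exponents C m ⊆ exponents (t • C) n := by
  intro α hα
  rw [mem_exponents] at hα ⊢
  rw [ConvexBody.coe_smul, smul_smul, mul_comm]
  obtain ⟨x, hx, hxα⟩ := hα
  rcases eq_or_lt_of_le ((Nat.cast_nonneg m).trans hmn) with h0 | h0
  · have hm : (m : ℝ) = 0 := le_antisymm (h0 ▸ hmn) (Nat.cast_nonneg m)
    rw [← h0, ← hm]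
    exact ⟨x, hx, hxα⟩
  -- By convexity, `m x = t n • (m / (t n)) x` with `(m / (t n)) x` on the segment from `0` to `x`.
  · refine ⟨(m / (t * n) : ℝ) • x, ?_, ?_⟩
    · exact C.convex.smul_mem_of_zero_mem hC.zero_mem hx ⟨by positivity, (div_le_one h0).2 hmn⟩
    · simp only [smul_smul]
      rw [mul_div_cancel₀ _ h0.ne']
      exact hxα

/-- By the asymptotics of lattice point counts, `t n C` has only `o(n ^ d)` more lattice points
than `⌊t n⌋ C`. -/
theorem tendsto_card_sdiff_div_pow {d : ℕ} {C : ConvexBody (Fin d → ℝ)}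
    (hC : SimplexComparable C) {t : ℝ} (ht : 0 < t) :
    Tendsto (fun n : ℕ => ((exponents (t • C) n \ exponents C ⌊t * n⌋₊).card : ℝ) / (n : ℝ) ^ d)
      atTop (𝓝 0) := by
  have hfl : Tendsto (fun n : ℕ => ⌊t * (n : ℝ)⌋₊) atTop atTop :=
    tendsto_nat_floor_atTop.comp (tendsto_natCast_atTop_atTop.const_mul_atTop ht)
  have hA := (tendsto_card_exponents_div_pow hC).comp hfl
  have hB := tendsto_card_exponents_div_pow (hC.smul ht)
  have hvol : volume.real ((t • C : ConvexBody (Fin d → ℝ)) : Set (Fin d → ℝ)) =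
      volume.real (C : Set (Fin d → ℝ)) * t ^ d := by
    rw [ConvexBody.coe_smul, Measure.real, Measure.addHaar_smul_of_nonneg _ ht.le,
      ENNReal.toReal_mul, ENNReal.toReal_ofReal (by positivity), Module.finrank_fin_fun, mul_comm]
    rfl
  have hr : Tendsto (fun n : ℕ => (⌊t * (n : ℝ)⌋₊ : ℝ) / n) atTop (𝓝 t) :=
    (tendsto_nat_floor_mul_div_atTop ht.le).comp tendsto_natCast_atTop_atTop
  have h := hB.sub (hA.mul (hr.pow d))
  rw [hvol, sub_self] at h
  refine h.congr' ?_
  filter_upwards [hfl.eventually_ge_atTop 1] with n hn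
  have hn0 : ((⌊t * (n : ℝ)⌋₊ : ℕ) : ℝ) ≠ 0 := by exact_mod_cast (by omega : ⌊t * (n : ℝ)⌋₊ ≠ 0)
  have hsub : exponents C ⌊t * (n : ℝ)⌋₊ ⊆ exponents (t • C) n :=
    exponents_subset_exponents_smul hC (Nat.floor_le (by positivity))
  rw [Finset.cast_card_sdiff hsub, sub_div]
  simp only [Function.comp_apply]
  rw [div_pow]
  field_simp

/-! ### Comparison of transfinite diameters -/

theorem IsCompact.exists_nat_enorm_le {d : ℕ} {K : Set (Fin d → ℂ)} (hK : IsCompact K) :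
    ∃ M : ℕ, 1 ≤ M ∧ ∀ z ∈ K, ∀ i, ‖z i‖ₑ ≤ (M : ℝ≥0∞) := by
  obtain ⟨r, hr⟩ := hK.isBounded.exists_norm_le
  refine ⟨⌈r⌉₊ + 1, by omega, fun z hz i => ?_⟩
  have h : ‖z i‖ ≤ ((⌈r⌉₊ + 1 : ℕ) : ℝ) := by
    have h1 := (norm_le_pi_norm z i).trans ((hr z hz).trans (Nat.le_ceil r))
    push_cast
    linarith
  rw [enorm_eq_nnnorm, ← ENNReal.coe_natCast, ENNReal.coe_le_coe, ← NNReal.coe_le_coe]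
  simpa using h

theorem degreeSum_eq_add_sdiff {d m n : ℕ} {C C' : ConvexBody (Fin d → ℝ)}
    (h : exponents C m ⊆ exponents C' n) :
    degreeSum C' n = ∑ α ∈ exponents C' n \ exponents C m, ∑ i, α i + degreeSum C m :=
  (Finset.sum_sdiff h).symm

/-- If the exponents of `C` at level `m` are among those of `C'` at level `n`, each of the
additional exponents contributes to the maximal Vandermonde determinant a factor that is at most
exponential in `n`. -/
theorem exists_maxVandermonde_le {d : ℕ} (C : ConvexBody (Fin d → ℝ))
    {C' : ConvexBody (Fin d → ℝ)} (hC' : SimplexComparable C')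
    {K : Set (Fin d → ℂ)} (hK : IsCompact K) :
    ∃ R : ℕ, 1 ≤ R ∧ ∀ m n : ℕ, exponents C m ⊆ exponents C' n →
      maxVandermonde C' K n ≤
        (R : ℝ≥0∞) ^ (n * (exponents C' n \ exponents C m).card) * maxVandermonde C K m := by
  obtain ⟨D, hD⟩ := hC'.exists_degree_le
  obtain ⟨M, hM1, hM⟩ := hK.exists_nat_enorm_le
  refine ⟨2 ^ (D * d) * M ^ D, Nat.one_le_iff_ne_zero.2 (by positivity), fun m n hmn => ?_⟩
  simp only [maxVandermonde_eq_maxDet]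
  refine (maxDet_le_of_subset hM hmn).trans ?_
  gcongr
  set p := (exponents C' n \ exponents C m).card with hp
  have hdeg : ∑ α ∈ exponents C' n \ exponents C m, ∑ i, α i ≤ p * (D * n) := by
    rw [hp, ← smul_eq_mul]
    exact Finset.sum_le_card_nsmul _ _ _ fun α hα => hD n α (Finset.mem_sdiff.1 hα).1
  have h : (exponents C' n).card ^ p *
      M ^ (∑ α ∈ exponents C' n \ exponents C m, ∑ i, α i) ≤
      (2 ^ (D * d) * M ^ D) ^ (n * p) := by
    calc _ ≤ ((2 ^ (D * d)) ^ n) ^ p * M ^ (p * (D * n)) := by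
          gcongr
          exact card_exponents_le (hD n)
      _ = _ := by ring
  exact_mod_cast h

/-- The maximal determinants for `t C` at level `n` are compared with those for `C` at level
`⌊t n⌋`. -/
theorem transfiniteDiameter_smul_le {d : ℕ} (hd : 1 ≤ d) {C : ConvexBody (Fin d → ℝ)}
    (hC : SimplexComparable C) {K : Set (Fin d → ℂ)} (hK : IsCompact K) {t : ℝ} (ht : 0 < t) :
    transfiniteDiameter (t • C) K ≤ transfiniteDiameter C K := by
  refine le_of_forall_gt_imp_ge_of_dense fun c hc => ?_
  rcases eq_or_ne c ⊤ with rfl | hctop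
  · exact le_top
  have hc0 : 0 < c.toReal := ENNReal.toReal_pos (bot_le.trans_lt hc).ne' hctop
  have hcc : c = ENNReal.ofReal c.toReal := (ENNReal.ofReal_toReal hctop).symm
  set x := c.toReal
  have hCt := hC.smul ht
  obtain ⟨R, hR1, hR⟩ := exists_maxVandermonde_le C hCt hK
  obtain ⟨D, hD⟩ := hCt.exists_degree_le
  obtain ⟨κ, hκ, hl⟩ := hCt.exists_le_degreeSum hd
  obtain ⟨κ', hκ', hl'⟩ := hC.exists_le_degreeSum hd
  have hfl : Tendsto (fun n : ℕ => ⌊t * (n : ℝ)⌋₊) atTop atTop :=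
    tendsto_nat_floor_atTop.comp (tendsto_natCast_atTop_atTop.const_mul_atTop ht)
  have hsub : ∀ n : ℕ, exponents C ⌊t * (n : ℝ)⌋₊ ⊆ exponents (t • C) n := fun n =>
    exponents_subset_exponents_smul hC (Nat.floor_le (by positivity))
  obtain ⟨p, hp⟩ : ∃ p : ℕ → ℕ, ∀ n : ℕ,
      (exponents (t • C) n \ exponents C ⌊t * (n : ℝ)⌋₊).card = p n := ⟨_, fun _ => rfl⟩
  have hp0 := tendsto_card_sdiff_div_pow hC ht
  simp only [hp] at hp0
  have hlpos : ∀ᶠ n : ℕ in atTop, 0 < degreeSum (t • C) n := by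
    filter_upwards [hl, eventually_gt_atTop 0] with n hn hn0
    have : (0 : ℝ) < κ * (n : ℝ) ^ (d + 1) := by positivity
    exact_mod_cast this.trans_le hn
  -- The degree sum has order `n ^ (d + 1)`, while `p n = o(n ^ d)`.
  have hu : Tendsto (fun n : ℕ => ((n * p n : ℕ) : ℝ) / degreeSum (t • C) n) atTop (𝓝 0) := by
    have h0 := hp0.const_mul κ⁻¹
    rw [mul_zero] at h0
    refine squeeze_zero' (Eventually.of_forall fun n => by positivity) ?_ h0
    filter_upwards [hl, eventually_gt_atTop 0] with n hn hn0
    have hn0' : (0 : ℝ) < n := by exact_mod_cast hn0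
    calc ((n * p n : ℕ) : ℝ) / degreeSum (t • C) n
        ≤ ((n * p n : ℕ) : ℝ) / (κ * (n : ℝ) ^ (d + 1)) := by gcongr
      _ = κ⁻¹ * ((p n : ℝ) / (n : ℝ) ^ d) := by
        push_cast
        field_simp
        ring
  -- The two degree sums differ by at most `p n` degrees, each at most `D n`.
  have hv : Tendsto (fun n : ℕ => (degreeSum C ⌊t * (n : ℝ)⌋₊ : ℝ) / degreeSum (t • C) n) atTop
      (𝓝 1) := by
    have h1 := (hu.const_mul (D : ℝ)).const_sub 1
    rw [mul_zero, sub_zero] at h1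
    refine tendsto_of_tendsto_of_tendsto_of_le_of_le' h1 tendsto_const_nhds ?_ ?_
    · filter_upwards [hlpos] with n hn
      have hn' : (0 : ℝ) < degreeSum (t • C) n := by exact_mod_cast hn
      rw [← mul_div_assoc, one_sub_div hn'.ne']
      gcongr
      have h2 : ∑ α ∈ exponents (t • C) n \ exponents C ⌊t * (n : ℝ)⌋₊, ∑ i, α i ≤
          p n * (D * n) := by
        rw [← hp, ← smul_eq_mul]
        exact Finset.sum_le_card_nsmul _ _ _ fun α hα => hD n α (Finset.mem_sdiff.1 hα).1
      have h3 : degreeSum (t • C) n ≤ D * (n * p n) + degreeSum C ⌊t * (n : ℝ)⌋₊ := by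
        rw [degreeSum_eq_add_sdiff (hsub n)]
        linarith
      rw [sub_le_iff_le_add']
      exact_mod_cast h3
    · filter_upwards [hlpos] with n hn
      rw [div_le_one (by exact_mod_cast hn)]
      exact_mod_cast Finset.sum_le_sum_of_subset (hsub n)
  have hlim : Tendsto (fun n : ℕ => ENNReal.ofReal
      ((R : ℝ) ^ (((n * p n : ℕ) : ℝ) / degreeSum (t • C) n) *
        x ^ ((degreeSum C ⌊t * (n : ℝ)⌋₊ : ℝ) / degreeSum (t • C) n))) atTop (𝓝 c) := by
    have hR0 : (R : ℝ) ≠ 0 := by exact_mod_cast (by omega : R ≠ 0)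
    have h := ((Real.continuousAt_const_rpow hR0).tendsto.comp hu).mul
      ((Real.continuousAt_const_rpow hc0.ne').tendsto.comp hv)
    rw [Real.rpow_zero, Real.rpow_one, one_mul] at h
    rw [hcc]
    exact (ENNReal.continuous_ofReal.tendsto _).comp h
  have hlt : ∀ᶠ m : ℕ in atTop, maxVandermonde C K m ≤ ENNReal.ofReal (x ^ degreeSum C m) := by
    filter_upwards [eventually_lt_of_limsup_lt hc, hl', eventually_gt_atTop 0] with m hm hlm hm0
    have hlm0 : (0 : ℝ) < degreeSum C m :=
      lt_of_lt_of_le (by positivity : (0 : ℝ) < κ' * (m : ℝ) ^ (d + 1)) hlm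
    have h := (ENNReal.rpow_le_rpow_iff hlm0).2 hm.le
    rw [← ENNReal.rpow_mul, one_div_mul_cancel hlm0.ne', ENNReal.rpow_one, hcc,
      ENNReal.rpow_natCast, ← ENNReal.ofReal_pow hc0.le] at h
    exact h
  rw [← hlim.limsup_eq]
  refine limsup_le_limsup ?_
  filter_upwards [hfl.eventually hlt, hlpos] with n hn hn0
  have h1 : maxVandermonde (t • C) K n ≤
      ENNReal.ofReal ((R : ℝ) ^ (n * p n) * x ^ degreeSum C ⌊t * (n : ℝ)⌋₊) := by
    refine (hR _ n (hsub n)).trans ?_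
    rw [hp, ENNReal.ofReal_mul (by positivity), ENNReal.ofReal_pow (by positivity),
      ENNReal.ofReal_natCast]
    gcongr
  refine (ENNReal.rpow_le_rpow h1 (by positivity)).trans_eq ?_
  rw [ENNReal.ofReal_rpow_of_nonneg (by positivity) (by positivity),
    Real.mul_rpow (by positivity) (by positivity), ← Real.rpow_natCast_mul (by positivity),
    ← Real.rpow_natCast_mul (by positivity), mul_one_div, mul_one_div]

theorem proposition2p1 (d : ℕ) (hd : 1 ≤ d) (C : ConvexBody (Fin d → ℝ))
    (hC : SimplexComparable C) (K : Set (Fin d → ℂ)) (hK : IsCompact K) (t : ℝ) (ht : 0 < t) :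
    transfiniteDiameter (t • C) K = transfiniteDiameter C K := by
  refine (transfiniteDiameter_smul_le hd hC hK ht).antisymm ?_
  -- The reverse inequality is the same one for `t • C` and `t⁻¹`.
  have h := transfiniteDiameter_smul_le hd (hC.smul ht) hK (inv_pos.2 ht)
  have hC' : t⁻¹ • t • C = C := SetLike.coe_injective <| by
    rw [ConvexBody.coe_smul, ConvexBody.coe_smul, inv_smul_smul₀ ht.ne']
  rwa [hC'] at h
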